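/- Let $\mathcal A$ be a unital $O^*$-algebra on a dense subspace $\mathcal D$ of a complex Hilbert space $\mathcal H$, that is, a unital algebra of linear operators $\mathcal D\to\mathcal D$ such that for each $\hat B\in\mathcal A$ the adjoint $\hat B^*$ is defined on $\mathcal D$ and $\hat B^*|_{\mathcal D}\in\mathcal A$. Let the state space $\mathcal E_S(\mathcal A)$ be the set of density operators $\rho$ on $\mathcal H$ (positive, trace class, $\mathrm{Tr}\,\rho=1$) with $\rho\mathcal H\subset\mathcal D$ and $\hat B\rho$ trace class for all $\hat B\in\mathcal A$, with the weak topology, whose open sub-base consists of the sets $\{\rho : |\mathrm{Tr}\,\rho\hat B-\mathrm{Tr}\,\rho_0\hat B|<\epsilon\}$ with $\hat B\in\mathcal A$, $\rho_0\in\mathcal E_S(\mathcal A)$, $\epsilon>0$. For $\hat B\in\mathcal A$ essentially self-adjoint and $U\subset\mathcal E_S(\mathcal A)$ open, let $b_Q(U)$ be the function $\rho\mapsto\mathrm{Tr}\,\rho\hat B$ on $U$. A qr-number is a continuous real function on an open subset of $\mathcal E_S(\mathcal A)$, and it is locally linear if near each point of this subset it agrees with $b_Q$ for some essentially self-adjoint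 $\hat B\in\mathcal A$. The distance $|f-g|$ of two qr-numbers is the absolute value of the difference of their prolongations by zero to $\mathcal E_S(\mathcal A)$. A sequence $(f_k)$ of qr-numbers is Cauchy if for each $\epsilon>0$ every state has an open neighbourhood $U$ and an index $N$ such that $|f_k-f_l|<\epsilon$ on $U$ for all $k,l\ge N$; it converges to $g$ if for each $\epsilon>0$ every state has an open neighbourhood $U$ and an index $N$ such that $|f_k-g|<\epsilon$ on $U$ for all $k\ge N$. The sequence is uniformly Cauchy, or converges uniformly to $g$, if in the respective condition $U=\mathcal E_S(\mathcal A)$ can be taken. Fix an essentially self-adjoint operator $\hat A\in\mathcal A$ and a sequence $(V_k)$ of open subsets of $\mathcal E_S(\mathcal A)$. If the sequence of locally linear qr-numbers $a_Q(V_k)$ is Cauchy, then it converges to a locally linear qr-number $a_Q(W)$ for some (possibly empty) open subset $W$ of $\mathcal E_S(\mathcal A)$. If the sequence is uniformly Cauchy, then it converges uniformly to a locally linear qr-number $a_Q(W)$ for some open subset $W$ of $\mathcal E_S(\mathcal A)$. -/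

import Mathlib

open Filter Topology TopologicalSpace
open scoped InnerProductSpace

noncomputable section

section TraceClass

variable {H : Type*} [NormedAddCommGroup H] [InnerProductSpace ℂ H] [CompleteSpace H]

/-- A bounded operator `T` is trace class if `Tr |T| < ∞`, where `|T| = √(T* T)` and the trace of
the positive operator `|T|` is computed in orthonormal bases. -/
def IsTraceClass (T : H →L[ℂ] H) : Prop :=
  ∀ (w : Set H) (b : HilbertBasis w ℂ H),
    Summable fun i => (⟪b i, (CFC.abs T : H →L[ℂ] H) (b i)⟫_ℂ).re

/-- An everywhere defined linear map that is a (bounded) trace class operator. -/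
def LinearMap.IsTraceClassMap (S : H →ₗ[ℂ] H) : Prop :=
  ∃ T : H →L[ℂ] H, (T : H →ₗ[ℂ] H) = S ∧ IsTraceClass T

/-- The index set of a fixed orthonormal basis of `H`. -/
def traceBasisIndex (H : Type*) [NormedAddCommGroup H] [InnerProductSpace ℂ H]
    [CompleteSpace H] : Set H :=
  (exists_hilbertBasis ℂ H).choose

/-- A fixed orthonormal basis of `H`. -/
def traceBasis (H : Type*) [NormedAddCommGroup H] [InnerProductSpace ℂ H]
    [CompleteSpace H] : HilbertBasis (traceBasisIndex H) ℂ H :=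
  (exists_hilbertBasis ℂ H).choose_spec.choose

/-- The trace `Tr S = ∑ ⟨eᵢ, S eᵢ⟩`. It is only used for trace class `S`, where the series converges
absolutely and its sum does not depend on the orthonormal basis. -/
def opTrace (S : H →ₗ[ℂ] H) : ℂ :=
  ∑' i, ⟪traceBasis H i, S (traceBasis H i)⟫_ℂ

end TraceClass

/-- A unital `O*`-algebra on a dense subspace `domain` of `H`: a unital algebra of linear operators
`domain → domain` such that for each member `A` the Hilbert space adjoint `A*` is defined on
`domain`, maps `domain` into itself, and its restriction to `domain` is again a member. -/
structure OStarAlgebra (H : Type*) [NormedAddCommGroup H] [InnerProductSpace ℂ H] where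
  /-- the common invariant domain of the operators -/
  domain : Submodule ℂ H
  dense_domain : Dense (domain : Set H)
  /-- the operators -/
  ops : Subalgebra ℂ (Module.End ℂ domain)
  exists_adjoint : ∀ A ∈ ops, ∃ B ∈ ops, ∀ φ ψ : domain,
    ⟪((A φ : domain) : H), (ψ : H)⟫_ℂ = ⟪(φ : H), ((B ψ : domain) : H)⟫_ℂ

namespace OStarAlgebra

variable {H : Type*} [NormedAddCommGroup H] [InnerProductSpace ℂ H] [CompleteSpace H]

/-- An operator of an `O*`-algebra as a densely defined operator in `H`. -/
def toPMap (𝒜 : OStarAlgebra H) (A : 𝒜.ops) : H →ₗ.[ℂ] H :=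
  ⟨𝒜.domain, 𝒜.domain.subtype ∘ₗ (A : Module.End ℂ 𝒜.domain)⟩

/-- `A` is essentially self-adjoint (on the common domain): its closure is self-adjoint. -/
def IsEssentiallySelfAdjoint (𝒜 : OStarAlgebra H) (A : 𝒜.ops) : Prop :=
  IsSelfAdjoint (𝒜.toPMap A).closure

/-- The states of an `O*`-algebra: the density operators `ρ` (positive, of trace one) with
`ρ H ⊆ domain` and with `A ρ` trace class for each operator `A` of the algebra. -/
structure State (𝒜 : OStarAlgebra H) where
  /-- the density operator -/
  op : H →L[ℂ] H
  isPositive : op.IsPositive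
  isTraceClass : IsTraceClass op
  trace_eq_one : opTrace (op : H →ₗ[ℂ] H) = 1
  mem_domain : ∀ x, op x ∈ 𝒜.domain
  isTraceClass_mul : ∀ A : 𝒜.ops, LinearMap.IsTraceClassMap
    (𝒜.domain.subtype ∘ₗ (A : Module.End ℂ 𝒜.domain) ∘ₗ
      (op : H →ₗ[ℂ] H).codRestrict 𝒜.domain mem_domain)

variable {𝒜 : OStarAlgebra H}

/-- The operator `A ρ` on `H`. -/
def mulState (A : 𝒜.ops) (ρ : 𝒜.State) : H →ₗ[ℂ] H :=
  𝒜.domain.subtype ∘ₗ (A : Module.End ℂ 𝒜.domain) ∘ₗ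
    (ρ.op : H →ₗ[ℂ] H).codRestrict 𝒜.domain ρ.mem_domain

/-- The expectation value `Tr ρ A = Tr A ρ`. -/
def expect (A : 𝒜.ops) (ρ : 𝒜.State) : ℂ :=
  opTrace (mulState A ρ)

/-- The weak topology on the state space: the sets
`𝒩(ρ₀; A; ε) = {ρ | |Tr ρ A - Tr ρ₀ A| < ε}` form a sub-base of open sets. -/
instance : TopologicalSpace 𝒜.State :=
  generateFrom {N | ∃ (ρ₀ : 𝒜.State) (A : 𝒜.ops) (ε : ℝ), 0 < ε ∧
    N = {ρ | ‖expect A ρ - expect A ρ₀‖ < ε}}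

/-- The real-valued function `a_Q(ρ) = Tr ρ A` on the state space. For an essentially self-adjoint
`A` the trace is real, so that taking the real part only changes the codomain. -/
def aQ (A : 𝒜.ops) (ρ : 𝒜.State) : ℝ :=
  (expect A ρ).re

theorem continuous_expect (A : 𝒜.ops) : Continuous (expect A : 𝒜.State → ℂ) := by
  rw [continuous_iff_continuousAt]
  intro ρ
  rw [ContinuousAt, Metric.tendsto_nhds]
  intro ε hε
  have ho : IsOpen {σ : 𝒜.State | ‖expect A σ - expect A ρ‖ < ε} :=
    isOpen_generateFrom_of_mem ⟨ρ, A, ε, hε, rfl⟩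
  filter_upwards [ho.mem_nhds (by simpa using hε)] with σ hσ
  rw [dist_eq_norm]
  exact hσ

theorem continuous_aQ (A : 𝒜.ops) : Continuous (aQ A : 𝒜.State → ℝ) :=
  Complex.continuous_re.comp (continuous_expect A)

/-- A qr-number: a section of the sheaf of Dedekind reals on the state space, that is, a continuous
real function on an open set, its extent. -/
structure QRNumber (𝒜 : OStarAlgebra H) where
  /-- the extent -/
  extent : Opens 𝒜.State
  /-- the continuous function -/
  toFun : C(extent, ℝ)

/-- The qr-number `a_Q(U)`, the restriction of `a_Q` to the open set `U`. -/
def aQOn (A : 𝒜.ops) (U : Opens 𝒜.State) : QRNumber 𝒜 where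
  extent := U
  toFun := ⟨fun ρ => aQ A ρ, (continuous_aQ A).comp continuous_subtype_val⟩

namespace QRNumber

/-- A qr-number is locally linear if near each point of its extent it agrees with `b_Q` for some
essentially self-adjoint operator `B` of the algebra. -/
def IsLocallyLinear (f : QRNumber 𝒜) : Prop :=
  ∀ ρ : f.extent, ∃ U : Opens 𝒜.State, (ρ : 𝒜.State) ∈ U ∧ U ≤ f.extent ∧
    ∃ B : 𝒜.ops, 𝒜.IsEssentiallySelfAdjoint B ∧
      ∀ σ : f.extent, (σ : 𝒜.State) ∈ U → f.toFun σ = aQ B σ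

open Classical in
/-- The prolongation by zero of a qr-number to the whole state space. -/
def prolong (f : QRNumber 𝒜) (ρ : 𝒜.State) : ℝ :=
  if h : ρ ∈ f.extent then f.toFun ⟨ρ, h⟩ else 0

/-- The distance `|f - g|` of two qr-numbers prolonged by zero, a real function on the state
space. -/
def distance (f g : QRNumber 𝒜) (ρ : 𝒜.State) : ℝ :=
  |f.prolong ρ - g.prolong ρ|

/-- A Cauchy sequence of qr-numbers, in the sense of sheaves: for each `ε > 0` the state space is
covered by open sets `U` such that `|f k - f l| < ε` on `U` for all `k, l` from some index on. -/
def IsCauchy (f : ℕ → QRNumber 𝒜) : Prop :=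
  ∀ ε : ℝ, 0 < ε → ∀ ρ₀ : 𝒜.State, ∃ U : Opens 𝒜.State, ρ₀ ∈ U ∧
    ∃ N : ℕ, ∀ k ≥ N, ∀ l ≥ N, ∀ ρ ∈ U, distance (f k) (f l) ρ < ε

/-- Convergence of a sequence of qr-numbers, in the sense of sheaves: for each `ε > 0` the state
space is covered by open sets `U` such that `|f k - g| < ε` on `U` for all `k` from some index
on. -/
def ConvergesTo (f : ℕ → QRNumber 𝒜) (g : QRNumber 𝒜) : Prop :=
  ∀ ε : ℝ, 0 < ε → ∀ ρ₀ : 𝒜.State, ∃ U : Opens 𝒜.State, ρ₀ ∈ U ∧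
    ∃ N : ℕ, ∀ k ≥ N, ∀ ρ ∈ U, distance (f k) g ρ < ε

/-- A Cauchy sequence for the distance, uniformly on the state space. -/
def IsUniformlyCauchy (f : ℕ → QRNumber 𝒜) : Prop :=
  ∀ ε : ℝ, 0 < ε → ∃ N : ℕ, ∀ k ≥ N, ∀ l ≥ N, ∀ ρ, distance (f k) (f l) ρ < ε

/-- Convergence for the distance, uniformly on the state space. -/
def ConvergesUniformlyTo (f : ℕ → QRNumber 𝒜) (g : QRNumber 𝒜) : Prop :=
  ∀ ε : ℝ, 0 < ε → ∃ N : ℕ, ∀ k ≥ N, ∀ ρ, distance (f k) g ρ < ε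

end QRNumber

end OStarAlgebra

end

/-!
The prolongation of `a_Q(U)` is the indicator of `U` times the continuous function `a = a_Q`, so
the distance of `a_Q(U)` and `a_Q(U')` is `|a|` on the symmetric difference of `U` and `U'` and zero
elsewhere. Near a state `ρ₀` with `a ρ₀ ≠ 0` the function `|a|` is bounded below by
`|a ρ₀| / 2 > 0`, and the Cauchy condition for this number forces the sets `V k` to coincide near
`ρ₀` from some index on (`exists_nhd_forall_mem_iff`). Hence the set `W` of those states with
`a ρ ≠ 0` which lie in `V k` for all large `k` is open (`isOpen_eventualExtent`), and at each single
state the prolongations of the `a_Q(V k)` are eventually equal to that of `a_Q(W)`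
(`eventually_prolong_eq`); at the zeros of `a` all of them vanish. Any bound on the distance of
`a_Q(V k)` and `a_Q(V l)` for all large `l` is therefore a bound on the distance of `a_Q(V k)` and
`a_Q(W)` (`distance_lt_of_forall_distance_lt`), which turns the Cauchy condition into convergence on
the same neighbourhood, and the uniform Cauchy condition into uniform convergence.
-/

open Filter Topology TopologicalSpace

namespace OStarAlgebra

variable {H : Type*} [NormedAddCommGroup H] [InnerProductSpace ℂ H] [CompleteSpace H]
  {𝒜 : OStarAlgebra H} {A : 𝒜.ops} {V : ℕ → Opens 𝒜.State}

namespace QRNumber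

theorem IsUniformlyCauchy.isCauchy {f : ℕ → QRNumber 𝒜} (hf : IsUniformlyCauchy f) :
    IsCauchy f := fun ε hε _ =>
  let ⟨N, hN⟩ := hf ε hε
  ⟨⊤, trivial, N, fun k hk l hl ρ _ => hN k hk l hl ρ⟩

theorem prolong_aQOn_of_mem {U : Opens 𝒜.State} {ρ : 𝒜.State} (h : ρ ∈ U) :
    (aQOn A U).prolong ρ = aQ A ρ :=
  dif_pos h

theorem prolong_aQOn_of_notMem {U : Opens 𝒜.State} {ρ : 𝒜.State} (h : ρ ∉ U) :
    (aQOn A U).prolong ρ = 0 :=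
  dif_neg h

theorem prolong_aQOn_of_aQ_eq_zero (U : Opens 𝒜.State) {ρ : 𝒜.State} (h : aQ A ρ = 0) :
    (aQOn A U).prolong ρ = 0 := by
  by_cases hU : ρ ∈ U
  · rw [prolong_aQOn_of_mem hU, h]
  · exact prolong_aQOn_of_notMem hU

theorem prolong_aQOn_congr {U U' : Opens 𝒜.State} {ρ : 𝒜.State} (h : ρ ∈ U ↔ ρ ∈ U') :
    (aQOn A U).prolong ρ = (aQOn A U').prolong ρ := by
  by_cases hU : ρ ∈ U
  · rw [prolong_aQOn_of_mem hU, prolong_aQOn_of_mem (h.1 hU)]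
  · rw [prolong_aQOn_of_notMem hU, prolong_aQOn_of_notMem (mt h.2 hU)]

theorem mem_iff_mem_of_distance_lt {U U' : Opens 𝒜.State} {ρ : 𝒜.State}
    (h : distance (aQOn A U) (aQOn A U') ρ < |aQ A ρ|) : ρ ∈ U ↔ ρ ∈ U' := by
  unfold distance at h
  by_cases hU : ρ ∈ U <;> by_cases hU' : ρ ∈ U'
  · exact iff_of_true hU hU'
  · simp [prolong_aQOn_of_mem hU, prolong_aQOn_of_notMem hU'] at h
  · simp [prolong_aQOn_of_notMem hU, prolong_aQOn_of_mem hU'] at h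
  · exact iff_of_false hU hU'

theorem isLocallyLinear_aQOn (hA : 𝒜.IsEssentiallySelfAdjoint A) (U : Opens 𝒜.State) :
    (aQOn A U).IsLocallyLinear := fun ρ =>
  ⟨U, ρ.2, le_rfl, A, hA, fun _ _ => rfl⟩

/-- Near a state at which `a_Q` does not vanish, the members of a Cauchy sequence have the same
extent from some index on. -/
theorem exists_nhd_forall_mem_iff (hV : IsCauchy fun k => aQOn A (V k)) {ρ₀ : 𝒜.State}
    (h₀ : aQ A ρ₀ ≠ 0) :
    ∃ U : Opens 𝒜.State, ρ₀ ∈ U ∧ ∃ N : ℕ, ∀ ρ ∈ U, aQ A ρ ≠ 0 ∧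
      ∀ k ≥ N, ∀ l ≥ N, ρ ∈ V k ↔ ρ ∈ V l := by
  have hpos : 0 < |aQ A ρ₀| := abs_pos.2 h₀
  obtain ⟨U, hU, N, hN⟩ := hV _ (half_pos hpos) ρ₀
  have hopen : IsOpen {ρ : 𝒜.State | |aQ A ρ₀| / 2 < |aQ A ρ|} :=
    isOpen_lt continuous_const (continuous_aQ A).abs
  refine ⟨U ⊓ ⟨_, hopen⟩, ⟨hU, half_lt_self hpos⟩, N, fun ρ hρ => ⟨?_, fun k hk l hl => ?_⟩⟩
  · exact abs_pos.1 ((half_pos hpos).trans hρ.2)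
  · exact mem_iff_mem_of_distance_lt ((hN k hk l hl ρ hρ.1).trans hρ.2)

variable (A V) in
/-- The states at which `a_Q` does not vanish and which lie in `V k` for all large `k`. The zeros of
`a_Q` are left out: a zero may lie in every `V k` without an open neighbourhood of it doing so for
large `k`, and the prolongation of `a_Q` by zero does not see them. -/
def eventualExtent : Set 𝒜.State :=
  {ρ | aQ A ρ ≠ 0 ∧ ∀ᶠ k in atTop, ρ ∈ V k}

theorem isOpen_eventualExtent (hV : IsCauchy fun k => aQOn A (V k)) :
    IsOpen (eventualExtent A V) := by
  rw [isOpen_iff_mem_nhds]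
  rintro ρ₀ ⟨h₀, hev⟩
  obtain ⟨U, hU, N, hN⟩ := exists_nhd_forall_mem_iff hV h₀
  obtain ⟨k, hk, hkN⟩ := (hev.and (eventually_ge_atTop N)).exists
  filter_upwards [U.isOpen.mem_nhds hU, (V k).isOpen.mem_nhds hk] with ρ hρ hρk
  refine ⟨(hN ρ hρ).1, ?_⟩
  filter_upwards [eventually_ge_atTop N] with l hl
  exact ((hN ρ hρ).2 k hkN l hl).1 hρk

/-- At each state the prolongations of a Cauchy sequence of the `a_Q(V k)` are eventually constant,
and their eventual value is that of the limit. -/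
theorem eventually_prolong_eq (hV : IsCauchy fun k => aQOn A (V k)) (ρ : 𝒜.State) :
    ∀ᶠ l in atTop, (aQOn A (V l)).prolong ρ =
      (aQOn A ⟨eventualExtent A V, isOpen_eventualExtent hV⟩).prolong ρ := by
  by_cases h₀ : aQ A ρ = 0
  · exact Eventually.of_forall fun l => by
      rw [prolong_aQOn_of_aQ_eq_zero _ h₀, prolong_aQOn_of_aQ_eq_zero _ h₀]
  obtain ⟨U, hU, N, hN⟩ := exists_nhd_forall_mem_iff hV h₀
  filter_upwards [eventually_ge_atTop N] with l hl
  refine prolong_aQOn_congr ⟨fun h => ⟨h₀, ?_⟩, fun h => ?_⟩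
  · filter_upwards [eventually_ge_atTop N] with k hk
    exact ((hN ρ hU).2 l hl k hk).1 h
  · obtain ⟨k, hk, hkN⟩ := (h.2.and (eventually_ge_atTop N)).exists
    exact ((hN ρ hU).2 k hkN l hl).1 hk

/-- The strict bound survives the passage to the limit, because the prolongations at `ρ` are
eventually equal to that of the limit. -/
theorem distance_lt_of_forall_distance_lt (hV : IsCauchy fun k => aQOn A (V k)) {f : QRNumber 𝒜}
    {ρ : 𝒜.State} {ε : ℝ} {N : ℕ} (h : ∀ l ≥ N, distance f (aQOn A (V l)) ρ < ε) :
    distance f (aQOn A ⟨eventualExtent A V, isOpen_eventualExtent hV⟩) ρ < ε := by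
  obtain ⟨l, hl, hlN⟩ := ((eventually_prolong_eq hV ρ).and (eventually_ge_atTop N)).exists
  have := h l hlN
  rwa [distance, hl] at this

end QRNumber

end OStarAlgebra

open OStarAlgebra.QRNumber in
theorem proposition29 {H : Type*} [NormedAddCommGroup H] [InnerProductSpace ℂ H] [CompleteSpace H]
    (𝒜 : OStarAlgebra H) (A : 𝒜.ops) (hA : 𝒜.IsEssentiallySelfAdjoint A)
    (V : ℕ → TopologicalSpace.Opens 𝒜.State) :
    (OStarAlgebra.QRNumber.IsCauchy (fun k => OStarAlgebra.aQOn A (V k)) →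
      ∃ W : TopologicalSpace.Opens 𝒜.State,
        (OStarAlgebra.aQOn A W).IsLocallyLinear ∧
        OStarAlgebra.QRNumber.ConvergesTo (fun k => OStarAlgebra.aQOn A (V k))
          (OStarAlgebra.aQOn A W)) ∧
    (OStarAlgebra.QRNumber.IsUniformlyCauchy (fun k => OStarAlgebra.aQOn A (V k)) →
      ∃ W : TopologicalSpace.Opens 𝒜.State,
        (OStarAlgebra.aQOn A W).IsLocallyLinear ∧
        OStarAlgebra.QRNumber.ConvergesUniformlyTo (fun k => OStarAlgebra.aQOn A (V k))
          (OStarAlgebra.aQOn A W)) := by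
  refine ⟨fun hV => ⟨⟨_, isOpen_eventualExtent hV⟩, isLocallyLinear_aQOn hA _,
    fun ε hε ρ₀ => ?_⟩, fun hV => ⟨⟨_, isOpen_eventualExtent hV.isCauchy⟩,
    isLocallyLinear_aQOn hA _, fun ε hε => ?_⟩⟩
  · obtain ⟨U, hU, N, hN⟩ := hV ε hε ρ₀
    exact ⟨U, hU, N, fun k hk ρ hρ =>
      distance_lt_of_forall_distance_lt hV fun l hl => hN k hk l hl ρ hρ⟩
  · obtain ⟨N, hN⟩ := hV ε hε
    exact ⟨N, fun k hk ρ =>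
      distance_lt_of_forall_distance_lt hV.isCauchy fun l hl => hN k hk l hl ρ⟩
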